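/- Let $n\ge 2$, let $\mathbb F$ be a field in which $2\neq 0$, and let $q\in\mathbb F^\times$. For $k\in\mathbb Z$ put $[k]=q+q^3+\dots+q^{2k-1}$ if $k\ge 0$ and $[k]=-q^{-1}-q^{-3}-\dots-q^{2k+1}$ if $k<0$. Assume that $[1],\dots,[n]$ are non-zero, and that $-1,[1],\dots,[n]$ have square roots in $\mathbb F$; fix such square roots, and put $\sqrt{[0]}=0$. Let $\mathscr H_n$ be the unital associative $\mathbb F$-algebra with generators $T_1,\dots,T_{n-1}$ and relations $(T_i-q)(T_i+q^{-1})=0$, $T_iT_j=T_jT_i$ for $|i-j|>1$, and $T_iT_{i+1}T_i=T_{i+1}T_iT_{i+1}$. For $w\in\mathfrak S_n$ with a reduced expression $w=s_{i_1}\cdots s_{i_k}$ in the simple transpositions $s_i=(i,i+1)$ put $T_w=T_{i_1}\cdots T_{i_k}$ and $\varepsilon_w=(-1)^k$. Let $\#$ be the algebra automorphism of $\mathscr H_n$ with $T_i^\#=-T_i^{-1}$ for all $i$ (so that $T_w^\#=\varepsilon_wT_{w^{-1}}^{-1}$ for all $w\in\mathfrak S_n$), let $\mathscr A_n=\{a\in\mathscr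 H_n : a^\#=a\}$ be the alternating Hecke algebra, and put $A_w=\tfrac12(T_w+\varepsilon_wT_w^\#)$, which lies in $\mathscr A_n$ if $w$ is in the alternating group $\mathfrak A_n$. For $k>0$ put $\alpha_k=\sqrt{-1}\sqrt{[k+1]}\sqrt{[k-1]}/[k]$ and $\alpha_{-k}=-\alpha_k$. Let $\lambda$ be a partition of $n$. For a standard $\lambda$-tableau $\mathfrak t$ let $c_{\mathfrak t}(i)$ be the column minus the row of the entry $i$, let $\rho_{\mathfrak t}(i)=c_{\mathfrak t}(i)-c_{\mathfrak t}(i+1)$, let $\mathfrak ts_i$ be $\mathfrak t$ with $i$ and $i+1$ exchanged, and let $\mathfrak t'$ be the conjugate (transposed) tableau. Let $S(\lambda)$ be the right $\mathscr H_n$-module with basis $\{v_{\mathfrak t}\}$ indexed by the standard $\lambda$-tableaux and with action \[ v_{\mathfrak t}T_i=\frac{-1}{[\rho_{\mathfrak t}(i)]}v_{\mathfrak t}+\alpha_{\mathfrak t}(i)v_{\mathfrak ts_i}\qquad(1\le i<n), \] where $\alpha_{\mathfrak t}(i)=\alpha_{\rho_{\mathfrak t}(i)}$ if $\mathfrak ts_i$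 is standard and $\alpha_{\mathfrak t}(i)=0$ otherwise, and let $\chi^\lambda$ be its character. Suppose now that $\lambda$ equals its conjugate partition $\lambda'$. Let $\tau$ be the linear endomorphism of $S(\lambda)$ with $\tau(v_{\mathfrak t})=v_{\mathfrak t'}$, and for $h\in\mathscr H_n$ let $\chi^\lambda(h\tau)$ be the trace on $S(\lambda)$ of the composite of $\tau$ with right multiplication by $h$. Let $S(\lambda)^\pm$ be the span of the vectors $v_{\mathfrak t}\pm v_{\mathfrak t'}$, where $\mathfrak t$ runs over the standard $\lambda$-tableaux with $2$ in the first row; it is an $\mathscr A_n$-submodule of $S(\lambda)$. Let $\chi^{\lambda\pm}_{\mathscr A}$ be its character. Then, for all $a\in\mathscr A_n$, \[ \chi^{\lambda\pm}_{\mathscr A}(a)=\tfrac12\bigl(\chi^\lambda(a)\pm\chi^\lambda(a\tau)\bigr), \] and, for all $w\in\mathfrak A_n$, \[ \chi^{\lambda\pm}_{\mathscr A}(A_w)=\tfrac12\bigl(\chi^\lambda(T_w)\pm\chi^\lambda(T_w\tau)\bigr). \] -/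

import Mathlib

namespace AltHecke

noncomputable section

variable {F : Type*} [Field F]

/-! ### The Iwahori–Hecke algebra of the symmetric group on `Fin n`

The generators `T_1, …, T_{n-1}` are indexed by `Fin (n - 1)`; the generator with index `i`
belongs to the transposition of `i` and `i + 1` in `Fin n = {0, …, n - 1}`. -/

/-- The first of the two points exchanged by the `i`-th simple transposition. -/
def lo {n : ℕ} (i : Fin (n - 1)) : Fin n := ⟨i, by omega⟩

/-- The second of the two points exchanged by the `i`-th simple transposition. -/
def hi {n : ℕ} (i : Fin (n - 1)) : Fin n := ⟨i + 1, by omega⟩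

/-- The simple transposition `s_i`. -/
def simpleTransp {n : ℕ} (i : Fin (n - 1)) : Equiv.Perm (Fin n) := Equiv.swap (lo i) (hi i)

/-- The defining relations of the Iwahori–Hecke algebra, on the free algebra. -/
inductive HeckeRel (q : Fˣ) (n : ℕ) :
    FreeAlgebra F (Fin (n - 1)) → FreeAlgebra F (Fin (n - 1)) → Prop
  | quad (i : Fin (n - 1)) : HeckeRel q n
      ((FreeAlgebra.ι F i - algebraMap F _ (q : F)) *
        (FreeAlgebra.ι F i + algebraMap F _ ((q : F)⁻¹))) 0
  | comm (i j : Fin (n - 1)) (h : (i : ℕ) + 1 < j) : HeckeRel q n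
      (FreeAlgebra.ι F i * FreeAlgebra.ι F j) (FreeAlgebra.ι F j * FreeAlgebra.ι F i)
  | braid (i j : Fin (n - 1)) (h : (j : ℕ) = i + 1) : HeckeRel q n
      (FreeAlgebra.ι F i * FreeAlgebra.ι F j * FreeAlgebra.ι F i)
      (FreeAlgebra.ι F j * FreeAlgebra.ι F i * FreeAlgebra.ι F j)

/-- The Iwahori–Hecke algebra of type `A_{n-1}` with parameter `q`. -/
def Hecke (q : Fˣ) (n : ℕ) : Type _ := RingQuot (HeckeRel q n)

instance (q : Fˣ) (n : ℕ) : Ring (Hecke q n) := inferInstanceAs (Ring (RingQuot (HeckeRel q n)))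

instance (q : Fˣ) (n : ℕ) : Algebra F (Hecke q n) :=
  inferInstanceAs (Algebra F (RingQuot (HeckeRel q n)))

/-- The canonical surjection from the free algebra. -/
def heckeMk (q : Fˣ) (n : ℕ) : FreeAlgebra F (Fin (n - 1)) →ₐ[F] Hecke q n :=
  RingQuot.mkAlgHom F (HeckeRel q n)

lemma heckeMk_rel {q : Fˣ} {n : ℕ} {x y : FreeAlgebra F (Fin (n - 1))} (h : HeckeRel q n x y) :
    heckeMk q n x = heckeMk q n y :=
  RingQuot.mkAlgHom_rel F h

/-- The generator `T_i`. -/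
def heckeGen (q : Fˣ) (n : ℕ) (i : Fin (n - 1)) : Hecke q n :=
  heckeMk q n (FreeAlgebra.ι F i)

/-- The universal property of the presentation. -/
def heckeLift (q : Fˣ) (n : ℕ) {B : Type*} [Ring B] [Algebra F B] (f : Fin (n - 1) → B)
    (hquad : ∀ i, (f i - algebraMap F B (q : F)) * (f i + algebraMap F B ((q : F)⁻¹)) = 0)
    (hcomm : ∀ i j : Fin (n - 1), (i : ℕ) + 1 < j → f i * f j = f j * f i)
    (hbraid : ∀ i j : Fin (n - 1), (j : ℕ) = i + 1 → f i * f j * f i = f j * f i * f j) :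
    Hecke q n →ₐ[F] B :=
  RingQuot.liftAlgHom F ⟨FreeAlgebra.lift F f, by
    intro x y h
    cases h with
    | quad i => simpa using hquad i
    | comm i j h => simpa using hcomm i j h
    | braid i j h => simpa using hbraid i j h⟩

@[simp] lemma heckeLift_gen (q : Fˣ) (n : ℕ) {B : Type*} [Ring B] [Algebra F B]
    (f : Fin (n - 1) → B) (h₁) (h₂) (h₃) (i : Fin (n - 1)) :
    heckeLift q n f h₁ h₂ h₃ (heckeGen q n i) = f i := by
  exact (RingQuot.liftAlgHom_mkAlgHom_apply F _ _ _).trans (FreeAlgebra.lift_ι_apply _ _)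

lemma heckeGen_quad (q : Fˣ) (n : ℕ) (i : Fin (n - 1)) :
    (heckeGen q n i - algebraMap F _ (q : F)) *
      (heckeGen q n i + algebraMap F _ ((q : F)⁻¹)) = 0 := by
  simpa [heckeGen] using heckeMk_rel (HeckeRel.quad (q := q) (n := n) i)

lemma heckeGen_comm (q : Fˣ) (n : ℕ) (i j : Fin (n - 1)) (h : (i : ℕ) + 1 < j) :
    heckeGen q n i * heckeGen q n j = heckeGen q n j * heckeGen q n i := by
  simpa [heckeGen] using heckeMk_rel (HeckeRel.comm (q := q) (n := n) i j h)

lemma heckeGen_braid (q : Fˣ) (n : ℕ) (i j : Fin (n - 1)) (h : (j : ℕ) = i + 1) :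
    heckeGen q n i * heckeGen q n j * heckeGen q n i =
      heckeGen q n j * heckeGen q n i * heckeGen q n j := by
  simpa [heckeGen] using heckeMk_rel (HeckeRel.braid (q := q) (n := n) i j h)

lemma hecke_hom_ext {q : Fˣ} {n : ℕ} {B : Type*} [Ring B] [Algebra F B]
    {f g : Hecke q n →ₐ[F] B} (h : ∀ i, f (heckeGen q n i) = g (heckeGen q n i)) : f = g := by
  refine RingQuot.ringQuot_ext' F f g (FreeAlgebra.hom_ext ?_)
  funext i
  exact h i

/-- Every element of the Hecke algebra is built from the generators. -/
lemma hecke_induction {q : Fˣ} {n : ℕ} {P : Hecke q n → Prop}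
    (hscalar : ∀ c : F, P (algebraMap F _ c)) (hgen : ∀ i, P (heckeGen q n i))
    (hadd : ∀ x y, P x → P y → P (x + y)) (hmul : ∀ x y, P x → P y → P (x * y))
    (x : Hecke q n) : P x := by
  obtain ⟨y, rfl⟩ : ∃ y, heckeMk q n y = x := RingQuot.mkAlgHom_surjective F (HeckeRel q n) x
  induction y using FreeAlgebra.induction with
  | grade0 r => simpa using hscalar r
  | grade1 i => exact hgen i
  | mul a b ha hb => rw [map_mul]; exact hmul _ _ ha hb
  | add a b ha hb => rw [map_add]; exact hadd _ _ ha hb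

/-- The inverse `T_i⁻¹ = T_i - q + q⁻¹`. -/
def heckeGenInv (q : Fˣ) (n : ℕ) (i : Fin (n - 1)) : Hecke q n :=
  heckeGen q n i - algebraMap F _ ((q : F) - (q : F)⁻¹)

lemma heckeGen_sq (q : Fˣ) (n : ℕ) (i : Fin (n - 1)) :
    heckeGen q n i * heckeGen q n i =
      ((q : F) - (q : F)⁻¹) • heckeGen q n i + 1 := by
  have h := heckeGen_quad q n i
  have hq : (q : F) * (q : F)⁻¹ = 1 := mul_inv_cancel₀ q.ne_zero
  simp only [Algebra.algebraMap_eq_smul_one, sub_mul, mul_add, mul_smul_comm, smul_mul_assoc,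
    mul_one, one_mul] at h
  rw [← sub_eq_zero, ← h]
  match_scalars <;> simp
  ring

lemma heckeGen_mul_inv (q : Fˣ) (n : ℕ) (i : Fin (n - 1)) :
    heckeGen q n i * heckeGenInv q n i = 1 := by
  rw [heckeGenInv, mul_sub, heckeGen_sq, Algebra.algebraMap_eq_smul_one, mul_smul_comm, mul_one]
  abel

lemma heckeGen_inv_mul (q : Fˣ) (n : ℕ) (i : Fin (n - 1)) :
    heckeGenInv q n i * heckeGen q n i = 1 := by
  rw [heckeGenInv, sub_mul, heckeGen_sq, Algebra.algebraMap_eq_smul_one, smul_mul_assoc, one_mul]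
  abel

/-- `T_i` as a unit of the Hecke algebra. -/
def heckeUnit (q : Fˣ) (n : ℕ) (i : Fin (n - 1)) : (Hecke q n)ˣ :=
  ⟨heckeGen q n i, heckeGenInv q n i, heckeGen_mul_inv q n i, heckeGen_inv_mul q n i⟩

/-- The algebra endomorphism `#` of the Hecke algebra with `T_i^# = -T_i⁻¹` for all `i`; it is the
unique algebra endomorphism with `T_x^# = (-1)^{ℓ(x)} (T_{x⁻¹})⁻¹` for every permutation `x`. -/
def hash (q : Fˣ) (n : ℕ) : Hecke q n →ₐ[F] Hecke q n :=
  heckeLift q n (fun i => -heckeGenInv q n i)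
    (by
      intro i
      have hq : (q : F) * (q : F)⁻¹ = 1 := mul_inv_cancel₀ q.ne_zero
      simp only [heckeGenInv, Algebra.algebraMap_eq_smul_one, neg_sub, sub_mul, mul_add, mul_sub,
        mul_smul_comm, smul_mul_assoc, mul_one, one_mul, heckeGen_sq]
      match_scalars
      · linear_combination -hq
      · ring)
    (by
      intro i j h
      have : Commute (heckeUnit q n i) (heckeUnit q n j) :=
        Units.ext (heckeGen_comm q n i j h)
      have := congrArg Units.val (this.inv_inv).eq
      simpa [heckeUnit] using this)
    (by
      intro i j h
      have h1 : heckeUnit q n i * heckeUnit q n j * heckeUnit q n i =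
          heckeUnit q n j * heckeUnit q n i * heckeUnit q n j :=
        Units.ext (heckeGen_braid q n i j h)
      have h2 := congrArg (fun u : (Hecke q n)ˣ => ((u⁻¹ : (Hecke q n)ˣ) : Hecke q n)) h1
      simpa [heckeUnit, mul_assoc] using h2)

@[simp] lemma hash_gen (q : Fˣ) (n : ℕ) (i : Fin (n - 1)) :
    hash q n (heckeGen q n i) = -heckeGenInv q n i := by
  simp [hash]

@[simp] lemma hash_hash (q : Fˣ) (n : ℕ) (h : Hecke q n) : hash q n (hash q n h) = h := by
  have : (hash q n).comp (hash q n) = AlgHom.id F _ := by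
    apply hecke_hom_ext
    intro i
    simp [heckeGenInv]
  exact DFunLike.congr_fun this h

/-- The alternating Hecke algebra: the fixed-point subalgebra of `#`. -/
def altHecke (q : Fˣ) (n : ℕ) : Subalgebra F (Hecke q n) :=
  AlgHom.equalizer (hash q n) (AlgHom.id F (Hecke q n))

lemma mem_altHecke {q : Fˣ} {n : ℕ} {a : Hecke q n} : a ∈ altHecke q n ↔ hash q n a = a :=
  Iff.rfl

/-! ### Reduced expressions, and the elements `T_w` and `A_w` -/

/-- A reduced expression `w = s_{i_1} ⋯ s_{i_k}`: a word of minimal length in the simple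
transpositions with product `w`. -/
structure ReducedExpr {n : ℕ} (w : Equiv.Perm (Fin n)) where
  /-- The word `(i_1, …, i_k)`. -/
  word : List (Fin (n - 1))
  prod_eq : (word.map simpleTransp).prod = w
  minimal : ∀ l : List (Fin (n - 1)), (l.map simpleTransp).prod = w → word.length ≤ l.length

/-- The simple transpositions generate the symmetric group. -/
lemma exists_word {n : ℕ} (w : Equiv.Perm (Fin n)) :
    ∃ l : List (Fin (n - 1)), (l.map simpleTransp).prod = w := by
  cases n with
  | zero => exact ⟨[], Subsingleton.elim _ _⟩
  | succ m =>
    have hw : w ∈ Submonoid.closure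
        (Set.range fun i : Fin m => Equiv.swap i.castSucc i.succ) := by
      rw [Equiv.Perm.mclosure_swap_castSucc_succ]; trivial
    induction hw using Submonoid.closure_induction with
    | mem x hx =>
      obtain ⟨i, rfl⟩ := hx
      exact ⟨[i], by simp [simpleTransp, lo, hi]; rfl⟩
    | one => exact ⟨[], rfl⟩
    | mul x y _ _ hx hy =>
      obtain ⟨l, rfl⟩ := hx
      obtain ⟨l', rfl⟩ := hy
      exact ⟨l ++ l', by simp⟩

/-- Every permutation has a reduced expression. -/
instance {n : ℕ} (w : Equiv.Perm (Fin n)) : Nonempty (ReducedExpr w) := by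
  obtain ⟨l, hl, hmin⟩ := exists_minimal_of_wellFoundedLT
    (fun k : ℕ => ∃ l : List (Fin (n - 1)), l.length = k ∧ (l.map simpleTransp).prod = w)
    (by obtain ⟨l, hl⟩ := exists_word w; exact ⟨_, l, rfl, hl⟩)
  obtain ⟨l, rfl, hl⟩ := hl
  refine ⟨⟨l, hl, fun l' hl' => ?_⟩⟩
  by_contra h
  exact h (hmin ⟨l', rfl, hl'⟩ (by omega))

/-- `T_w = T_{i_1} ⋯ T_{i_k}` for a reduced expression `w = s_{i_1} ⋯ s_{i_k}`. -/
def heckeT (q : Fˣ) {n : ℕ} {w : Equiv.Perm (Fin n)} (e : ReducedExpr w) : Hecke q n :=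
  (e.word.map (heckeGen q n)).prod

/-- `A_w = ½ (T_w + (-1)^{ℓ(w)} T_w^#)`. -/
def heckeA (q : Fˣ) {n : ℕ} {w : Equiv.Perm (Fin n)} (e : ReducedExpr w) : Hecke q n :=
  (2 : F)⁻¹ • (heckeT q e + (-1 : F) ^ e.word.length • hash q n (heckeT q e))

lemma sign_word {n : ℕ} (l : List (Fin (n - 1))) :
    Equiv.Perm.sign (l.map simpleTransp).prod = (-1) ^ l.length := by
  induction l with
  | nil => simp
  | cons i l ih =>
    have : lo i ≠ hi i := by simp [lo, hi, Fin.ext_iff]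
    simp [ih, simpleTransp, Equiv.Perm.sign_swap this, pow_succ]

lemma heckeA_mem (q : Fˣ) {n : ℕ} (w : alternatingGroup (Fin n))
    (e : ReducedExpr (w : Equiv.Perm (Fin n))) : heckeA q e ∈ altHecke q n := by
  have h : Even e.word.length := by
    have h1 := sign_word e.word
    rw [e.prod_eq, Equiv.Perm.mem_alternatingGroup.mp w.2] at h1
    by_contra hodd
    rw [(Nat.not_even_iff_odd.mp hodd).neg_one_pow] at h1
    exact absurd h1 (by decide)
  rw [mem_altHecke, heckeA, h.neg_one_pow, one_smul, map_smul, map_add, hash_hash, add_comm]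

/-- `A_w`, for an even permutation `w`, as an element of the alternating Hecke algebra. -/
def altA (q : Fˣ) {n : ℕ} (w : alternatingGroup (Fin n))
    (e : ReducedExpr (w : Equiv.Perm (Fin n))) : altHecke q n :=
  ⟨heckeA q e, heckeA_mem q w e⟩

/-! ### Quantum integers and the choice of square roots -/

/-- The quantum integer `[k]`: `q + q³ + ⋯ + q^{2k-1}` for `k ≥ 0` and
`-q⁻¹ - q⁻³ - ⋯ - q^{2k+1}` for `k < 0`. -/
def qInt (q : Fˣ) : ℤ → F
  | Int.ofNat k => ∑ j ∈ Finset.range k, (q : F) ^ (2 * j + 1)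
  | Int.negSucc k => -∑ j ∈ Finset.range (k + 1), ((q : F)⁻¹) ^ (2 * j + 1)

lemma qInt_zero (q : Fˣ) : qInt q 0 = 0 := by
  change ∑ j ∈ Finset.range 0, (q : F) ^ (2 * j + 1) = 0
  simp

lemma qInt_succ (q : Fˣ) (k : ℤ) : qInt q (k + 1) = qInt q k + (q : F) ^ (2 * k + 1) := by
  rcases k with k | k
  · change ∑ j ∈ Finset.range (k + 1), (q : F) ^ (2 * j + 1) = _
    rw [Finset.sum_range_succ]
    congr 1
    exact (zpow_natCast (q : F) (2 * k + 1)).symm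
  · cases k with
    | zero =>
      change ∑ j ∈ Finset.range 0, (q : F) ^ (2 * j + 1) = -∑ j ∈ Finset.range (0 + 1), _ + _
      simp
    | succ k =>
      change -∑ j ∈ Finset.range (k + 1), ((q : F)⁻¹) ^ (2 * j + 1) =
        -∑ j ∈ Finset.range (k + 1 + 1), ((q : F)⁻¹) ^ (2 * j + 1) + _
      rw [Finset.sum_range_succ _ (k + 1)]
      have : (q : F) ^ (2 * Int.negSucc (k + 1) + 1) = ((q : F)⁻¹) ^ (2 * (k + 1) + 1) := by
        rw [inv_pow, ← zpow_natCast, ← zpow_neg]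
        congr 1
      rw [this]
      ring

lemma qInt_mul (q : Fˣ) (k : ℤ) :
    1 + ((q : F) - (q : F)⁻¹) * qInt q k = (q : F) ^ (2 * k) := by
  have hq : (q : F) ≠ 0 := q.ne_zero
  induction k using Int.induction_on with
  | zero => simp [qInt_zero]
  | succ k ih =>
    rw [qInt_succ, mul_add, ← add_assoc, ih, mul_add 2, zpow_add₀ hq, zpow_add₀ hq]
    field_simp
    simp [zpow_ofNat]
  | pred k ih =>
    have h := qInt_succ q (-(k : ℤ) - 1)
    rw [sub_add_cancel] at h
    rw [h] at ih
    have e1 : (q : F) ^ (2 * (-(k : ℤ) - 1) + 1) = (q : F) ^ (2 * -(k : ℤ)) * (q : F)⁻¹ := by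
      rw [← zpow_neg_one, ← zpow_add₀ hq]; congr 1; ring
    have e2 : (q : F) ^ (2 * (-(k : ℤ) - 1)) = (q : F) ^ (2 * -(k : ℤ)) * ((q : F)⁻¹ * (q : F)⁻¹) := by
      rw [← zpow_neg_one, ← zpow_add₀ hq, ← zpow_add₀ hq]; congr 1; ring
    rw [e1] at ih
    rw [e2]
    have hqq : (q : F) * (q : F)⁻¹ = 1 := mul_inv_cancel₀ hq
    linear_combination ih - (q : F) ^ (2 * -(k : ℤ)) * hqq

lemma qInt_add (q : Fˣ) (k l : ℤ) :
    qInt q (k + l) = qInt q k + (q : F) ^ (2 * k) * qInt q l := by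
  have hq : (q : F) ≠ 0 := q.ne_zero
  induction l using Int.induction_on with
  | zero => simp [qInt_zero]
  | succ l ih =>
    rw [← add_assoc, qInt_succ, qInt_succ, ih, mul_add (_ ^ _), ← zpow_add₀ hq, ← add_assoc]
    congr 2
    ring
  | pred l ih =>
    have h1 := qInt_succ q (k + (-(l : ℤ) - 1))
    have h2 := qInt_succ q (-(l : ℤ) - 1)
    rw [sub_add_cancel] at h2
    rw [show k + (-(l : ℤ) - 1) + 1 = k + -(l : ℤ) by ring, ih, h2, mul_add, ← zpow_add₀ hq,
      show 2 * k + (2 * (-(l : ℤ) - 1) + 1) = 2 * (k + (-(l : ℤ) - 1)) + 1 by ring] at h1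
    linear_combination -h1

lemma qInt_neg (q : Fˣ) (k : ℤ) : (q : F) ^ (2 * k) * qInt q (-k) = -qInt q k := by
  have h := qInt_add q k (-k)
  rw [add_neg_cancel, qInt_zero] at h
  linear_combination -h

/-- The standing assumptions on the ground field: `[1], …, [n]` are non-zero, and square roots of
`-1` and of `[1], …, [n]` in the field are fixed (the case `k = 0` says that `√[0] = 0`). -/
structure SquareRoots (q : Fˣ) (n : ℕ) where
  qInt_ne_zero : ∀ k : ℕ, 1 ≤ k → k ≤ n → qInt q k ≠ 0
  /-- `√-1` -/
  sqrtNegOne : F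
  sqrtNegOne_sq : sqrtNegOne ^ 2 = -1
  /-- `√[k]` -/
  sqrtQInt : ℕ → F
  sqrtQInt_sq : ∀ k : ℕ, k ≤ n → sqrtQInt k ^ 2 = qInt q k

variable {q : Fˣ} {n : ℕ}

/-- `√-1 √[k+1] √[k-1] / [k]` for `k > 0`. -/
def alphaPos (S : SquareRoots q n) (k : ℕ) : F :=
  S.sqrtNegOne * S.sqrtQInt (k + 1) * S.sqrtQInt (k - 1) / qInt q k

/-- The coefficients `α_k`, for `k ≠ 0`, with `α_{-k} = -α_k`. -/
def alpha (S : SquareRoots q n) (k : ℤ) : F :=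
  if 0 < k then alphaPos S k.natAbs else if k < 0 then -alphaPos S k.natAbs else 0

lemma alpha_neg (S : SquareRoots q n) (k : ℤ) : alpha S (-k) = -alpha S k := by
  rcases lt_trichotomy k 0 with h | h | h
  · simp [alpha, h, h.not_gt]
  · simp [alpha, h]
  · simp [alpha, h, h.not_gt]

lemma alpha_of_natAbs_eq_one (S : SquareRoots q n) {k : ℤ} (h : k.natAbs = 1) :
    alpha S k = 0 := by
  have h0 : S.sqrtQInt 0 = 0 := by
    have := S.sqrtQInt_sq 0 (Nat.zero_le _)
    rw [Nat.cast_zero, qInt_zero] at this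
    exact pow_eq_zero_iff (two_ne_zero) |>.mp this
  simp [alpha, alphaPos, h, h0]

lemma qInt_ne_zero (S : SquareRoots q n) {k : ℤ} (h0 : k ≠ 0) (hk : k.natAbs ≤ n) :
    qInt q k ≠ 0 := by
  have h1 := S.qInt_ne_zero k.natAbs (by omega) hk
  rcases Int.natAbs_eq k with h | h
  · rwa [← h] at h1
  · intro hz
    have h2 := qInt_neg q k
    rw [hz, neg_zero] at h2
    have : -k = (k.natAbs : ℤ) := by omega
    rw [this] at h2
    exact (mul_ne_zero (zpow_ne_zero _ q.ne_zero) h1) h2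

lemma alpha_mul_alpha_neg (S : SquareRoots q n) {k : ℤ} (h0 : k ≠ 0) (hk : k.natAbs < n) :
    alpha S k * alpha S (-k) = 1 - (q : F) ^ (2 * k) / qInt q k ^ 2 := by
  have hq : (q : F) ≠ 0 := q.ne_zero
  -- it suffices to treat positive `k`
  have key : ∀ m : ℕ, 1 ≤ m → m < n →
      -(alphaPos S m) ^ 2 = 1 - (q : F) ^ (2 * (m : ℤ)) / qInt q (m : ℤ) ^ 2 := by
    intro m hm hmn
    have hne := S.qInt_ne_zero m hm hmn.le
    have e1 := S.sqrtQInt_sq (m + 1) hmn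
    have e2 := S.sqrtQInt_sq (m - 1) (by omega)
    have e3 := S.sqrtNegOne_sq
    have e4 := qInt_succ q (m : ℤ)
    have e5 := qInt_succ q ((m : ℤ) - 1)
    have e6 := qInt_mul q (m : ℤ)
    rw [sub_add_cancel] at e5
    have c1 : (((m + 1 : ℕ)) : ℤ) = (m : ℤ) + 1 := by push_cast; ring
    have c2 : (((m - 1 : ℕ)) : ℤ) = (m : ℤ) - 1 := by omega
    rw [c1, e4] at e1
    rw [c2] at e2
    have z1 : (q : F) ^ (2 * (m : ℤ) + 1) = (q : F) ^ (2 * (m : ℤ)) * q := zpow_add_one₀ hq _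
    have z2 : (q : F) ^ (2 * ((m : ℤ) - 1) + 1) = (q : F) ^ (2 * (m : ℤ)) * (q : F)⁻¹ := by
      rw [← zpow_sub_one₀ hq]; congr 1; ring
    rw [z1] at e1
    rw [z2] at e5
    rw [alphaPos, div_pow, mul_pow, mul_pow, e1, e2, e3]
    have hqq : (q : F) * (q : F)⁻¹ = 1 := mul_inv_cancel₀ hq
    generalize (q : F) ^ (2 * (m : ℤ)) = X at *
    generalize qInt q ((m : ℤ) - 1) = v at *
    generalize qInt q (m : ℤ) = u at *
    rw [← neg_div, eq_sub_iff_add_eq, ← add_div, div_eq_one_iff_eq (pow_ne_zero 2 hne)]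
    have hv : v = u - X * (q : F)⁻¹ := by linear_combination -e5
    rw [hv]
    linear_combination X * e6 - X ^ 2 * hqq
  rw [alpha_neg]
  rcases lt_or_gt_of_ne h0 with h | h
  · have hk' := key k.natAbs (by omega) hk
    have hc : ((k.natAbs : ℕ) : ℤ) = -k := by omega
    rw [hc] at hk'
    have hn := qInt_neg q k
    have hn1 := qInt_ne_zero S h0 hk.le
    have hX : (q : F) ^ (2 * k) ≠ 0 := zpow_ne_zero _ hq
    have hXi : (q : F) ^ (2 * -k) = ((q : F) ^ (2 * k))⁻¹ := by rw [mul_neg, zpow_neg]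
    have hn2 : qInt q (-k) = -qInt q k / (q : F) ^ (2 * k) := by
      rw [eq_div_iff hX, mul_comm, hn]
    rw [hXi, hn2] at hk'
    have ha : alpha S k = -alphaPos S k.natAbs := by simp [alpha, h, h.not_gt]
    rw [ha]
    have : -alphaPos S k.natAbs * - -alphaPos S k.natAbs = -(alphaPos S k.natAbs) ^ 2 := by ring
    rw [this, hk']
    field_simp
  · have hk' := key k.natAbs (by omega) hk
    have hc : ((k.natAbs : ℕ) : ℤ) = k := by omega
    rw [hc] at hk'
    have ha : alpha S k = alphaPos S k.natAbs := by simp [alpha, h]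
    rw [ha, ← hk']
    ring

/-! ### Standard tableaux -/

/-- The diagram `lam` filled bijectively with the numbers `1, …, n`; the number `k + 1` is encoded
as `k : Fin n`. A cell `(r, c)` lies in row `r` and column `c`, both counted from `0`. -/
abbrev Tableau (lam : YoungDiagram) (n : ℕ) : Type := lam.cells ≃ Fin n

variable {lam mu : YoungDiagram}

/-- The entries increase along rows and down columns. -/
def IsStandard (t : Tableau lam n) : Prop :=
  ∀ x y : lam.cells, x ≠ y → x.1.1 ≤ y.1.1 → x.1.2 ≤ y.1.2 → t x < t y

/-- The set of standard `lam`-tableaux. -/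
abbrev StdTableau (lam : YoungDiagram) (n : ℕ) : Type := {t : Tableau lam n // IsStandard t}

/-- The content (column minus row) of an entry. -/
def content (t : Tableau lam n) (k : Fin n) : ℤ :=
  ((t.symm k).1.2 : ℤ) - ((t.symm k).1.1 : ℤ)

/-- The axial distance `c_t(i) - c_t(i+1)`. -/
def axialDist (t : Tableau lam n) (i : Fin (n - 1)) : ℤ := content t (lo i) - content t (hi i)

/-- The tableau `t s_i`, in which the entries `i` and `i + 1` are exchanged. -/
def tabSwap (t : Tableau lam n) (i : Fin (n - 1)) : Tableau lam n := t.trans (simpleTransp i)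

/-- The cells of a diagram and those of its transpose. -/
def cellSwap (h : lam.transpose = mu) : mu.cells ≃ lam.cells where
  toFun x := ⟨x.1.swap, by
    have h' : ∀ c ∈ mu, c.swap ∈ lam := fun c hc => by
      rwa [← h, YoungDiagram.mem_transpose] at hc
    exact h' _ x.2⟩
  invFun x := ⟨x.1.swap, by
    rw [YoungDiagram.mem_cells, ← h, YoungDiagram.mem_transpose, Prod.swap_swap]
    exact x.2⟩
  left_inv x := by simp
  right_inv x := by simp

/-- The conjugate tableau `t'`, with `t'(c, r) = t(r, c)`. -/
def conjTab (h : lam.transpose = mu) (t : Tableau lam n) : Tableau mu n := (cellSwap h).trans t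

lemma IsStandard.conj (h : lam.transpose = mu) {t : Tableau lam n} (ht : IsStandard t) :
    IsStandard (conjTab h t) := by
  intro x y hxy h1 h2
  exact ht _ _ (fun e => hxy ((cellSwap h).injective e)) h2 h1

/-- The conjugate of a standard tableau. -/
def conjStd (h : lam.transpose = mu) (t : StdTableau lam n) : StdTableau mu n :=
  ⟨conjTab h t.1, t.2.conj h⟩

lemma lo_ne_hi (i : Fin (n - 1)) : lo i ≠ hi i := by simp [lo, hi, Fin.ext_iff]

lemma content_tabSwap (t : Tableau lam n) (i : Fin (n - 1)) (k : Fin n) :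
    content (tabSwap t i) k = content t (simpleTransp i k) := by
  simp [content, tabSwap, simpleTransp]

lemma tabSwap_tabSwap (t : Tableau lam n) (i : Fin (n - 1)) : tabSwap (tabSwap t i) i = t := by
  ext x; simp [tabSwap, simpleTransp]

lemma content_conjTab (h : lam.transpose = mu) (t : Tableau lam n) (k : Fin n) :
    content (conjTab h t) k = -content t k := by
  simp [content, conjTab, cellSwap]

/-- Two cells cannot have a third one between them if their entries are consecutive. -/
lemma axialDist_of_not_standard {t : Tableau lam n} (ht : IsStandard t) {i : Fin (n - 1)}
    (hs : ¬ IsStandard (tabSwap t i)) : (axialDist t i).natAbs = 1 := by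
  unfold IsStandard at hs
  push Not at hs
  obtain ⟨x, y, hxy, h1, h2, h3⟩ := hs
  have hlt := ht x y hxy h1 h2
  have hx : t x = lo i ∧ t y = hi i := by
    simp only [tabSwap, simpleTransp, Equiv.trans_apply] at h3
    rw [Equiv.swap_apply_def, Equiv.swap_apply_def] at h3
    simp only [lo, hi, Fin.ext_iff, Fin.lt_def, Fin.le_def] at h3 hlt ⊢
    split_ifs at h3 <;> simp_all <;> omega
  obtain ⟨hx, hy⟩ := hx
  have hbetw : ∀ z : lam.cells, z ≠ x → z ≠ y → x.1.1 ≤ z.1.1 → x.1.2 ≤ z.1.2 →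
      z.1.1 ≤ y.1.1 → z.1.2 ≤ y.1.2 → False := by
    intro z hzx hzy a b c d
    have h4 := ht x z (Ne.symm hzx) a b
    have h5 := ht z y hzy c d
    rw [hx] at h4
    rw [hy] at h5
    simp only [lo, hi, Fin.lt_def] at h4 h5
    omega
  have e1 : t.symm (lo i) = x := by rw [← hx]; simp
  have e2 : t.symm (hi i) = y := by rw [← hy]; simp
  rw [axialDist, content, content, e1, e2]
  obtain ⟨⟨r, c⟩, hxm⟩ := x
  obtain ⟨⟨r', c'⟩, hym⟩ := y
  simp only [ne_eq, Subtype.mk.injEq, Prod.mk.injEq] at *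
  have hmem : ∀ a b, a ≤ r' → b ≤ c' → (a, b) ∈ lam.cells := fun a b ha hb =>
    lam.up_left_mem ha hb hym
  by_cases hr : r = r'
  · subst hr
    by_cases hc : c' = c + 1
    · subst hc; push_cast; omega
    · exact (hbetw ⟨(r, c + 1), hmem _ _ le_rfl (by omega)⟩ (by simp)
        (by simp; omega) (by simp) (by simp) (by simp) (by simp; omega)).elim
  · by_cases hc : c = c'
    · subst hc
      by_cases hr' : r' = r + 1
      · subst hr'; push_cast; omega
      · exact (hbetw ⟨(r + 1, c), hmem _ _ (by omega) le_rfl⟩ (by simp)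
          (by simp; omega) (by simp) (by simp) (by simp; omega) (by simp)).elim
    · exact (hbetw ⟨(r, c'), hmem _ _ (by omega) le_rfl⟩ (by simp; omega)
        (by simp; omega) (by simp) (by simp; omega) (by simp; omega) (by simp)).elim

/-- Entries of the same content differ by at least three. -/
lemma content_ne {t : Tableau lam n} (ht : IsStandard t) {k l : Fin n} (hkl : (k : ℕ) < l)
    (hl : (l : ℕ) ≤ k + 2) : content t k ≠ content t l := by
  intro h
  obtain ⟨x, rfl⟩ := t.surjective k
  obtain ⟨y, rfl⟩ := t.surjective l
  simp only [content, Equiv.symm_apply_apply] at h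
  have hxy : x ≠ y := by rintro rfl; exact lt_irrefl _ hkl
  obtain ⟨⟨r, c⟩, hxm⟩ := x
  obtain ⟨⟨r', c'⟩, hym⟩ := y
  simp only at h
  rcases le_or_gt r' r with hr | hr
  · have := ht _ _ hxy.symm (by simpa using hr) (by simp; omega)
    rw [Fin.lt_def] at this
    omega
  · have m1 : (r, c') ∈ lam.cells := lam.up_left_mem hr.le le_rfl hym
    have m2 : (r', c) ∈ lam.cells := lam.up_left_mem le_rfl (by omega) hym
    have a1 := ht ⟨(r, c), hxm⟩ ⟨(r, c'), m1⟩ (by simp; omega) (by simp) (by simp; omega)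
    have a2 := ht ⟨(r, c'), m1⟩ ⟨(r', c'), hym⟩ (by simp; omega) (by simp; omega) (by simp)
    have b1 := ht ⟨(r, c), hxm⟩ ⟨(r', c), m2⟩ (by simp; omega) (by simp; omega) (by simp)
    have b2 := ht ⟨(r', c), m2⟩ ⟨(r', c'), hym⟩ (by simp; omega) (by simp) (by simp; omega)
    rw [Fin.lt_def] at a1 a2 b1 b2
    have : t ⟨(r, c'), m1⟩ = t ⟨(r', c), m2⟩ := by apply Fin.ext; omega
    have := t.injective this
    simp at this
    omega

lemma content_sub_lt (t : Tableau lam n) (k l : Fin n) : content t k - content t l < n := by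
  have hcard : lam.cells.card = n := by simpa using Fintype.card_congr t
  obtain ⟨x, rfl⟩ := t.surjective k
  obtain ⟨y, rfl⟩ := t.surjective l
  simp only [content, Equiv.symm_apply_apply]
  obtain ⟨⟨r, c⟩, hx⟩ := x
  obtain ⟨⟨r', c'⟩, hy⟩ := y
  have hsub : (Finset.range (c + 1)).image (fun j => (0, j)) ∪
      (Finset.range r').image (fun j => (j + 1, 0)) ⊆ lam.cells := by
    intro z hz
    simp only [Finset.mem_union, Finset.mem_image, Finset.mem_range] at hz
    rcases hz with ⟨j, hj, rfl⟩ | ⟨j, hj, rfl⟩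
    · exact lam.up_left_mem (Nat.zero_le _) (by omega) hx
    · exact lam.up_left_mem (by omega) (Nat.zero_le _) hy
  have hle := Finset.card_le_card hsub
  rw [Finset.card_union_of_disjoint, Finset.card_image_of_injective, Finset.card_image_of_injective,
    Finset.card_range, Finset.card_range, hcard] at hle
  · change (c : ℤ) - (r : ℤ) - ((c' : ℤ) - (r' : ℤ)) < n
    omega
  · intro a b hab; simpa using hab
  · intro a b hab; simpa using hab
  · rw [Finset.disjoint_left]
    intro z hz hz'
    simp only [Finset.mem_image] at hz hz'
    obtain ⟨a, _, rfl⟩ := hz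
    obtain ⟨b, _, hb⟩ := hz'
    simp at hb

lemma natAbs_content_sub_lt (t : Tableau lam n) (k l : Fin n) :
    (content t k - content t l).natAbs < n := by
  have h1 := content_sub_lt t k l
  have h2 := content_sub_lt t l k
  omega

/-! ### The Specht module in seminormal form -/

/-- The vector space with basis `v_t`, for `t` a standard `lam`-tableau. -/
abbrev Specht (F : Type*) [Field F] (lam : YoungDiagram) (n : ℕ) : Type _ := StdTableau lam n →₀ F

/-- The basis vector `v_t`. -/
def vec (F : Type*) [Field F] (t : StdTableau lam n) : Specht F lam n := Finsupp.single t 1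

open Classical in
/-- The operator `v_t ↦ -1/[ρ_t(i)] v_t + α_t(i) v_{t s_i}` by which `T_i` acts, where `α_t(i)` is
`α_{ρ_t(i)}` if `t s_i` is standard, and zero otherwise. -/
def spechtOp (S : SquareRoots q n) (lam : YoungDiagram) (i : Fin (n - 1)) :
    Specht F lam n →ₗ[F] Specht F lam n :=
  Finsupp.linearCombination F fun t : StdTableau lam n =>
    (-1 / qInt q (axialDist t.1 i)) • vec F t +
      if h : IsStandard (tabSwap t.1 i) then alpha S (axialDist t.1 i) • vec F ⟨tabSwap t.1 i, h⟩
      else 0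

/-- The same operator on the space with all tableaux as a basis. -/
def genOp (S : SquareRoots q n) (lam : YoungDiagram) (i : Fin (n - 1)) :
    (Tableau lam n →₀ F) →ₗ[F] (Tableau lam n →₀ F) :=
  Finsupp.linearCombination F fun t : Tableau lam n =>
    (-1 / qInt q (axialDist t i)) • Finsupp.single t 1 +
      alpha S (axialDist t i) • Finsupp.single (tabSwap t i) 1

/-- The inclusion of the Specht module in the space spanned by all tableaux. -/
def incl (F : Type*) [Field F] (lam : YoungDiagram) (n : ℕ) :
    Specht F lam n →ₗ[F] (Tableau lam n →₀ F) :=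
  Finsupp.lmapDomain F F Subtype.val

lemma incl_injective : Function.Injective (incl F lam n) :=
  Finsupp.mapDomain_injective Subtype.val_injective

lemma incl_vec (t : StdTableau lam n) : incl F lam n (vec F t) = Finsupp.single t.1 1 := by
  simp [incl, vec]

lemma specht_ext {M : Type*} [AddCommMonoid M] [Module F M] {f g : Specht F lam n →ₗ[F] M}
    (h : ∀ t, f (vec F t) = g (vec F t)) : f = g := by
  apply Finsupp.lhom_ext'
  intro t
  apply LinearMap.ext_ring
  exact h t

lemma spechtOp_vec (S : SquareRoots q n) (i : Fin (n - 1)) (t : StdTableau lam n) :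
    spechtOp S lam i (vec F t) = (-1 / qInt q (axialDist t.1 i)) • vec F t +
      open Classical in
      if h : IsStandard (tabSwap t.1 i) then alpha S (axialDist t.1 i) • vec F ⟨tabSwap t.1 i, h⟩
      else 0 := by
  simp [spechtOp, vec]

lemma genOp_single (S : SquareRoots q n) (i : Fin (n - 1)) (t : Tableau lam n) :
    genOp S lam i (Finsupp.single t 1) =
      (-1 / qInt q (axialDist t i)) • Finsupp.single t 1 +
        alpha S (axialDist t i) • Finsupp.single (tabSwap t i) 1 := by
  simp [genOp]

lemma incl_spechtOp (S : SquareRoots q n) (i : Fin (n - 1)) (v : Specht F lam n) :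
    incl F lam n (spechtOp S lam i v) = genOp S lam i (incl F lam n v) := by
  suffices h : incl F lam n ∘ₗ spechtOp S lam i = genOp S lam i ∘ₗ incl F lam n from
    DFunLike.congr_fun h v
  apply specht_ext
  intro t
  simp only [LinearMap.comp_apply, spechtOp_vec, incl_vec, genOp_single, map_add, map_smul]
  congr 1
  split_ifs with h
  · rw [map_smul, incl_vec]
  · rw [map_zero, alpha_of_natAbs_eq_one S (axialDist_of_not_standard t.2 h), zero_smul]

lemma spechtOp_quad (S : SquareRoots q n) (i : Fin (n - 1)) (v : Specht F lam n) :
    spechtOp S lam i (spechtOp S lam i v) = ((q : F) - (q : F)⁻¹) • spechtOp S lam i v + v := by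
  suffices h : spechtOp S lam i ∘ₗ spechtOp S lam i =
      ((q : F) - (q : F)⁻¹) • spechtOp S lam i + LinearMap.id from DFunLike.congr_fun h v
  apply specht_ext
  intro t
  apply incl_injective
  simp only [LinearMap.comp_apply, LinearMap.add_apply, LinearMap.smul_apply, LinearMap.id_apply,
    map_add, map_smul, incl_spechtOp, incl_vec, genOp_single, tabSwap_tabSwap]
  have hd : axialDist (tabSwap t.1 i) i = -axialDist t.1 i := by
    simp [axialDist, content_tabSwap, simpleTransp]
  have h0 : axialDist t.1 i ≠ 0 :=
    sub_ne_zero.mpr (content_ne t.2 (by simp [lo, hi]) (by simp [lo, hi]))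
  have hn : (axialDist t.1 i).natAbs < n := natAbs_content_sub_lt _ _ _
  have hP := alpha_mul_alpha_neg S h0 hn
  have hu := qInt_ne_zero S h0 hn.le
  have hX := zpow_ne_zero (2 * axialDist t.1 i) q.ne_zero
  have hneg := qInt_neg q (axialDist t.1 i)
  have hm := qInt_mul q (axialDist t.1 i)
  rw [hd]
  generalize axialDist t.1 i = x at *
  have hn2 : qInt q (-x) = -qInt q x / (q : F) ^ (2 * x) := by
    rw [eq_div_iff hX, mul_comm, hneg]
  rw [hn2]
  generalize hz : (q : F) - (q : F)⁻¹ = z at *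
  rw [← hm] at hP hX ⊢
  match_scalars
  · rw [mul_one, mul_one, hP]
    field_simp
    ring
  · field_simp
    ring

lemma spechtOp_comm (S : SquareRoots q n) (i j : Fin (n - 1)) (hij : (i : ℕ) + 1 < j)
    (v : Specht F lam n) :
    spechtOp S lam i (spechtOp S lam j v) = spechtOp S lam j (spechtOp S lam i v) := by
  suffices h : spechtOp S lam i ∘ₗ spechtOp S lam j = spechtOp S lam j ∘ₗ spechtOp S lam i from
    DFunLike.congr_fun h v
  apply specht_ext
  intro t
  apply incl_injective
  have n1 : lo j ≠ lo i := by simp only [lo, ne_eq, Fin.mk.injEq]; omega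
  have n2 : lo j ≠ hi i := by simp only [lo, hi, ne_eq, Fin.mk.injEq]; omega
  have n3 : hi j ≠ lo i := by simp only [lo, hi, ne_eq, Fin.mk.injEq]; omega
  have n4 : hi j ≠ hi i := by simp only [hi, ne_eq, Fin.mk.injEq]; omega
  have d1 : axialDist (tabSwap t.1 i) j = axialDist t.1 j := by
    simp [axialDist, content_tabSwap, simpleTransp, Equiv.swap_apply_of_ne_of_ne, n1, n2, n3, n4]
  have d2 : axialDist (tabSwap t.1 j) i = axialDist t.1 i := by
    simp [axialDist, content_tabSwap, simpleTransp, Equiv.swap_apply_of_ne_of_ne, n1.symm,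
      n2.symm, n3.symm, n4.symm]
  have e : tabSwap (tabSwap t.1 i) j = tabSwap (tabSwap t.1 j) i := by
    apply Equiv.ext
    intro x
    have si1 : simpleTransp i (lo i) = hi i := Equiv.swap_apply_left _ _
    have si2 : simpleTransp i (hi i) = lo i := Equiv.swap_apply_right _ _
    have sj1 : simpleTransp j (lo j) = hi j := Equiv.swap_apply_left _ _
    have sj2 : simpleTransp j (hi j) = lo j := Equiv.swap_apply_right _ _
    have a1 : simpleTransp i (lo j) = lo j := Equiv.swap_apply_of_ne_of_ne n1 n2
    have a2 : simpleTransp i (hi j) = hi j := Equiv.swap_apply_of_ne_of_ne n3 n4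
    have b1 : simpleTransp j (lo i) = lo i := Equiv.swap_apply_of_ne_of_ne n1.symm n3.symm
    have b2 : simpleTransp j (hi i) = hi i := Equiv.swap_apply_of_ne_of_ne n2.symm n4.symm
    simp only [tabSwap, Equiv.trans_apply]
    by_cases h1 : t.1 x = lo i
    · rw [h1, si1, b1, b2, si1]
    by_cases h2 : t.1 x = hi i
    · rw [h2, si2, b1, b2, si2]
    by_cases h3 : t.1 x = lo j
    · rw [h3, sj1, a1, a2, sj1]
    by_cases h4 : t.1 x = hi j
    · rw [h4, sj2, a1, a2, sj2]
    have c1 : simpleTransp i (t.1 x) = t.1 x := Equiv.swap_apply_of_ne_of_ne h1 h2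
    have c2 : simpleTransp j (t.1 x) = t.1 x := Equiv.swap_apply_of_ne_of_ne h3 h4
    rw [c1, c2, c1]
  simp only [LinearMap.comp_apply, map_add, map_smul, incl_spechtOp, incl_vec, genOp_single,
    d1, d2, e]
  module

lemma seminormal_one {u v w X : F} (hu : u ≠ 0) (hv : v ≠ 0) (hw : w ≠ 0)
    (h : w = u + X * v) :
    -1 / u * (-1 / v) + -1 / w * (-1 / (-u / X)) = -1 / v * (-1 / w) := by
  field_simp
  linear_combination h

lemma seminormal_two {u v w X Y z : F} (hu : u ≠ 0) (hv : v ≠ 0) (hw : w ≠ 0)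
    (hX : X = 1 + z * u) (hY : Y = 1 + z * v) (h : w = u + X * v) :
    -1 / u * (-1 / v) * (-1 / u) + (1 - X / u ^ 2) * (-1 / w) =
      -1 / v * (-1 / u) * (-1 / v) + (1 - Y / v ^ 2) * (-1 / w) := by
  field_simp
  rw [h, hX, hY]
  ring

lemma spechtOp_braid (S : SquareRoots q n) (i j : Fin (n - 1)) (hij : (j : ℕ) = i + 1)
    (v : Specht F lam n) :
    spechtOp S lam i (spechtOp S lam j (spechtOp S lam i v)) =
      spechtOp S lam j (spechtOp S lam i (spechtOp S lam j v)) := by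
  suffices h : spechtOp S lam i ∘ₗ spechtOp S lam j ∘ₗ spechtOp S lam i =
      spechtOp S lam j ∘ₗ spechtOp S lam i ∘ₗ spechtOp S lam j from DFunLike.congr_fun h v
  apply specht_ext
  intro t
  apply incl_injective
  have hm : lo j = hi i := by simp only [lo, hi, Fin.mk.injEq]; omega
  have n1 : lo i ≠ hi i := lo_ne_hi i
  have n2 : hi i ≠ hi j := by rw [← hm]; exact lo_ne_hi j
  have n3 : lo i ≠ hi j := by simp only [lo, hi, ne_eq, Fin.mk.injEq]; omega
  have si1 : simpleTransp i (lo i) = hi i := Equiv.swap_apply_left _ _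
  have si2 : simpleTransp i (hi i) = lo i := Equiv.swap_apply_right _ _
  have si3 : simpleTransp i (hi j) = hi j := Equiv.swap_apply_of_ne_of_ne n3.symm n2.symm
  have sj1 : simpleTransp j (lo i) = lo i :=
    Equiv.swap_apply_of_ne_of_ne (by rw [hm]; exact n1) n3
  have sj2 : simpleTransp j (hi i) = hi j := by
    rw [← hm]; exact Equiv.swap_apply_left _ _
  have sj3 : simpleTransp j (hi j) = hi i := by
    rw [← hm]; exact Equiv.swap_apply_right _ _
  have e : tabSwap (tabSwap (tabSwap t.1 i) j) i = tabSwap (tabSwap (tabSwap t.1 j) i) j := by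
    apply Equiv.ext
    intro x
    simp only [tabSwap, Equiv.trans_apply]
    by_cases h1 : t.1 x = lo i
    · rw [h1, si1, sj2, si3, sj1, si1, sj2]
    by_cases h2 : t.1 x = hi i
    · rw [h2, si2, sj1, si1, sj2, si3, sj3]
    by_cases h3 : t.1 x = hi j
    · rw [h3, si3, sj3, si2, sj1]
    · have a1 : simpleTransp i (t.1 x) = t.1 x := Equiv.swap_apply_of_ne_of_ne h1 h2
      have a2 : simpleTransp j (t.1 x) = t.1 x :=
        Equiv.swap_apply_of_ne_of_ne (by rw [hm]; exact h2) h3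
      rw [a1, a2, a1, a2]
  have ha : content t.1 (lo i) - content t.1 (hi i) ≠ 0 :=
    sub_ne_zero.mpr (content_ne t.2 (by simp [lo, hi]) (by simp [lo, hi]))
  have hb : content t.1 (hi i) - content t.1 (hi j) ≠ 0 :=
    sub_ne_zero.mpr (content_ne t.2 (by simp [hi]; omega) (by simp [hi]; omega))
  have hc : content t.1 (lo i) - content t.1 (hi j) ≠ 0 :=
    sub_ne_zero.mpr (content_ne t.2 (by simp [lo, hi]; omega) (by simp [lo, hi]; omega))
  have ha' := natAbs_content_sub_lt t.1 (lo i) (hi i)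
  have hb' := natAbs_content_sub_lt t.1 (hi i) (hi j)
  have hc' := natAbs_content_sub_lt t.1 (lo i) (hi j)
  simp only [LinearMap.comp_apply, map_add, map_smul, incl_spechtOp, incl_vec, genOp_single, e,
    tabSwap_tabSwap, axialDist, content_tabSwap, si1, si2, si3, sj1, sj2, sj3, hm]
  generalize content t.1 (lo i) = a at *
  generalize content t.1 (hi i) = b at *
  generalize content t.1 (hi j) = c at *
  rw [← neg_sub a b, ← neg_sub b c]
  have hw : a - c = (a - b) + (b - c) := by ring
  have hadd := qInt_add q (a - b) (b - c)
  have hadd' := qInt_add q (b - c) (a - b)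
  rw [← hw] at hadd
  rw [show b - c + (a - b) = a - c by ring] at hadd'
  have hP := alpha_mul_alpha_neg S ha ha'
  have hQ := alpha_mul_alpha_neg S hb hb'
  have hu := qInt_ne_zero S ha ha'.le
  have hv := qInt_ne_zero S hb hb'.le
  have hw0 := qInt_ne_zero S hc hc'.le
  have hX := zpow_ne_zero (2 * (a - b)) q.ne_zero
  have hY := zpow_ne_zero (2 * (b - c)) q.ne_zero
  have hn1 : qInt q (-(a - b)) = -qInt q (a - b) / (q : F) ^ (2 * (a - b)) := by
    rw [eq_div_iff hX, mul_comm, qInt_neg]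
  have hn2 : qInt q (-(b - c)) = -qInt q (b - c) / (q : F) ^ (2 * (b - c)) := by
    rw [eq_div_iff hY, mul_comm, qInt_neg]
  have i0 := seminormal_two hu hv hw0 (qInt_mul q (a - b)).symm (qInt_mul q (b - c)).symm hadd
  have i1 := seminormal_one hu hv hw0 hadd
  have i2 := seminormal_one hv hu hw0 hadd'
  rw [← hn1] at i1
  rw [← hn2] at i2
  rw [← hP, ← hQ] at i0
  linear_combination (norm := module) i0 • (Finsupp.single t.1 1 : Tableau lam n →₀ F) +
    (alpha S (a - b) * i1) • (Finsupp.single (tabSwap t.1 i) 1 : Tableau lam n →₀ F) -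
    (alpha S (b - c) * i2) • (Finsupp.single (tabSwap t.1 j) 1 : Tableau lam n →₀ F)

/-- The Specht module `S(lam)` as a right module over the Hecke algebra: `h` acts on the right by
the operator `(spechtRep S lam h).unop`. -/
def spechtRep (S : SquareRoots q n) (lam : YoungDiagram) :
    Hecke q n →ₐ[F] (Module.End F (Specht F lam n))ᵐᵒᵖ :=
  heckeLift q n (fun i => MulOpposite.op (spechtOp S lam i))
    (by
      intro i
      apply MulOpposite.unop_injective
      apply LinearMap.ext
      intro v
      have hq : (q : F) * (q : F)⁻¹ = 1 := mul_inv_cancel₀ q.ne_zero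
      have h := spechtOp_quad S i v
      simp only [MulOpposite.unop_mul, MulOpposite.unop_sub, MulOpposite.unop_add,
        MulOpposite.algebraMap_apply, MulOpposite.unop_op, MulOpposite.unop_zero,
        Module.End.mul_apply, LinearMap.sub_apply, LinearMap.add_apply,
        Module.algebraMap_end_apply, map_sub, map_smul, h, LinearMap.zero_apply]
      match_scalars
      · ring
      · linear_combination -hq)
    (by
      intro i j h
      apply MulOpposite.unop_injective
      apply LinearMap.ext
      intro v
      exact (spechtOp_comm S i j h v).symm)
    (by
      intro i j h
      apply MulOpposite.unop_injective
      apply LinearMap.ext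
      intro v
      exact spechtOp_braid S i j h v)

/-- Right multiplication by `h` on the Specht module. -/
def spechtAct (S : SquareRoots q n) (lam : YoungDiagram) (h : Hecke q n) :
    Specht F lam n →ₗ[F] Specht F lam n :=
  (spechtRep S lam h).unop

/-- The linear map `τ : S(lam) → S(lam')` with `v_t ↦ v_{t'}`. -/
def tau (F : Type*) [Field F] (n : ℕ) (h : lam.transpose = mu) :
    Specht F lam n →ₗ[F] Specht F mu n :=
  Finsupp.lmapDomain F F (conjStd h)

/-- The character `χ^lam` of the Specht module. -/
def spechtChar (S : SquareRoots q n) (lam : YoungDiagram) (h : Hecke q n) : F :=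
  LinearMap.trace F (Specht F lam n) (spechtAct S lam h)

/-- `χ^lam(hτ)`: for `lam = lam'`, the trace of the endomorphism of `S(lam)` obtained by composing
right multiplication by `h` with `τ`. -/
def spechtTauChar (S : SquareRoots q n) (hlam : lam.transpose = lam) (h : Hecke q n) : F :=
  LinearMap.trace F (Specht F lam n) (spechtAct S lam h ∘ₗ tau F n hlam)

/-! ### The two halves of the Specht module of a self-conjugate partition -/

/-- The number `2` lies in the first row of `t`. -/
def TwoInFirstRow (t : StdTableau lam n) : Prop :=
  ∃ x : lam.cells, (t.1 x : ℕ) = 1 ∧ x.1.1 = 0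

/-- `S(lam)^ε`, for a sign `ε`: the span of all `v_t + ε v_{t'}`, where `t` runs over the standard
tableaux with `2` in the first row. -/
def spechtHalf (F : Type*) [Field F] (n : ℕ) (hlam : lam.transpose = lam) (ε : ℤˣ) :
    Submodule F (Specht F lam n) :=
  Submodule.span F {v | ∃ t : StdTableau lam n, TwoInFirstRow t ∧
    v = vec F t + ((ε : ℤ) : F) • vec F (conjStd hlam t)}

lemma tau_vec (h : lam.transpose = mu) (t : StdTableau lam n) :
    tau F n h (vec F t) = vec F (conjStd h t) := by
  simp [tau, vec]

lemma conjStd_conjStd (h : lam.transpose = lam) (t : StdTableau lam n) :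
    conjStd h (conjStd h t) = t := by
  apply Subtype.ext
  apply Equiv.ext
  intro x
  simp [conjStd, conjTab, cellSwap]

lemma conjTab_tabSwap (h : lam.transpose = lam) (t : Tableau lam n) (i : Fin (n - 1)) :
    conjTab h (tabSwap t i) = tabSwap (conjTab h t) i := rfl

/-- `τ` intertwines the action of `h` and that of `h^#`. -/
lemma tau_spechtAct (S : SquareRoots q n) (hlam : lam.transpose = lam) (h : Hecke q n) :
    ∀ v, tau F n hlam (spechtAct S lam h v) = spechtAct S lam (hash q n h) (tau F n hlam v) := by
  induction h using hecke_induction with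
  | hscalar c =>
    intro v
    simp [spechtAct, MulOpposite.algebraMap_apply, Module.algebraMap_end_apply]
  | hadd x y hx hy => intro v; simp_all [spechtAct]
  | hmul x y hx hy => intro v; simp_all [spechtAct]
  | hgen i =>
    suffices h : tau F n hlam ∘ₗ spechtAct S lam (heckeGen q n i) =
        spechtAct S lam (hash q n (heckeGen q n i)) ∘ₗ tau F n hlam from DFunLike.congr_fun h
    apply specht_ext
    intro t
    have g1 : spechtAct S lam (heckeGen q n i) = spechtOp S lam i := by
      simp [spechtAct, spechtRep]
    have g2 : ∀ v, spechtAct S lam (hash q n (heckeGen q n i)) v =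
        -spechtOp S lam i v + ((q : F) - (q : F)⁻¹) • v := by
      intro v
      rw [hash_gen, heckeGenInv, ← g1]
      simp only [spechtAct, map_neg, map_sub, AlgHom.commutes, MulOpposite.algebraMap_apply,
        MulOpposite.unop_neg, MulOpposite.unop_sub, MulOpposite.unop_op, LinearMap.neg_apply,
        LinearMap.sub_apply, Module.algebraMap_end_apply]
      module
    rw [LinearMap.comp_apply, LinearMap.comp_apply, g1, g2, tau_vec, spechtOp_vec, spechtOp_vec,
      map_add, map_smul, tau_vec]
    have hd : axialDist (conjStd hlam t).1 i = -axialDist t.1 i := by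
      simp only [axialDist, conjStd, content_conjTab]; ring
    have hstd : IsStandard (tabSwap (conjStd hlam t).1 i) ↔ IsStandard (tabSwap t.1 i) := by
      constructor
      · intro h'
        have := h'.conj hlam
        rw [conjTab_tabSwap] at this
        have e := congrArg Subtype.val (conjStd_conjStd hlam t)
        change conjTab hlam (conjStd hlam t).1 = t.1 at e
        rwa [e] at this
      · exact fun h' => h'.conj hlam
    have h0 : axialDist t.1 i ≠ 0 :=
      sub_ne_zero.mpr (content_ne t.2 (by simp [lo, hi]) (by simp [lo, hi]))
    have hn : (axialDist t.1 i).natAbs < n := natAbs_content_sub_lt _ _ _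
    have hu := qInt_ne_zero S h0 hn.le
    have hX := zpow_ne_zero (2 * axialDist t.1 i) q.ne_zero
    have hm := qInt_mul q (axialDist t.1 i)
    have hn2 : qInt q (-axialDist t.1 i) =
        -qInt q (axialDist t.1 i) / (q : F) ^ (2 * axialDist t.1 i) := by
      rw [eq_div_iff hX, mul_comm, qInt_neg]
    have hcoef : -1 / qInt q (axialDist t.1 i) =
        1 / qInt q (-axialDist t.1 i) + ((q : F) - (q : F)⁻¹) := by
      rw [hn2, ← hm]
      rw [← hm] at hX
      field_simp
      ring
    rw [hd, alpha_neg, hcoef]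
    by_cases hs : IsStandard (tabSwap t.1 i)
    · have hs' := hstd.mpr hs
      rw [dif_pos hs, dif_pos hs', map_smul, tau_vec]
      have : conjStd hlam ⟨tabSwap t.1 i, hs⟩ = ⟨tabSwap (conjStd hlam t).1 i, hs'⟩ := rfl
      rw [this]
      module
    · rw [dif_neg hs, dif_neg (fun h' => hs (hstd.mp h')), map_zero]
      module

lemma twoInFirstRow_or (hlam : lam.transpose = lam) (hn : 2 ≤ n) (t : StdTableau lam n) :
    TwoInFirstRow t ∨ TwoInFirstRow (conjStd hlam t) := by
  obtain ⟨x, hx⟩ := t.1.surjective ⟨1, by omega⟩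
  by_cases h1 : x.1.1 = 0
  · exact Or.inl ⟨x, by rw [hx], h1⟩
  by_cases h2 : x.1.2 = 0
  · refine Or.inr ⟨(cellSwap hlam).symm x, ?_, h2⟩
    simp [conjStd, conjTab, hx]
  exfalso
  obtain ⟨⟨r, c⟩, hm⟩ := x
  simp only at h1 h2
  have m1 : (0, c) ∈ lam.cells := lam.up_left_mem (Nat.zero_le _) le_rfl hm
  have m2 : (0, 0) ∈ lam.cells := lam.up_left_mem (Nat.zero_le _) (Nat.zero_le _) hm
  have a1 := t.2 ⟨(0, 0), m2⟩ ⟨(0, c), m1⟩ (by simp; omega) (by simp) (by simp)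
  have a2 := t.2 ⟨(0, c), m1⟩ ⟨(r, c), hm⟩ (by simp; omega) (by simp) (by simp)
  rw [hx, Fin.lt_def] at a2
  rw [Fin.lt_def] at a1
  simp only at a2
  omega

lemma add_tau_mem_spechtHalf (hlam : lam.transpose = lam) (hn : 2 ≤ n) (ε : ℤˣ)
    (v : Specht F lam n) : v + ((ε : ℤ) : F) • tau F n hlam v ∈ spechtHalf F n hlam ε := by
  have hv : v ∈ Submodule.span F (Set.range (vec F (lam := lam) (n := n))) := by
    have : vec F (lam := lam) (n := n) = Finsupp.basisSingleOne (R := F) := by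
      funext t; simp [vec]
    rw [this, Module.Basis.span_eq]
    trivial
  induction hv using Submodule.span_induction with
  | mem x hx =>
    obtain ⟨t, rfl⟩ := hx
    rw [tau_vec]
    rcases twoInFirstRow_or hlam hn t with h | h
    · exact Submodule.subset_span ⟨t, h, rfl⟩
    · have hmem : vec F (conjStd hlam t) + ((ε : ℤ) : F) • vec F (conjStd hlam (conjStd hlam t)) ∈
          spechtHalf F n hlam ε := Submodule.subset_span ⟨_, h, rfl⟩
      rw [conjStd_conjStd] at hmem
      have := Submodule.smul_mem _ ((ε : ℤ) : F) hmem
      convert this using 1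
      have hε : ((ε : ℤ) : F) * ((ε : ℤ) : F) = 1 := by
        rcases Int.units_eq_one_or ε with rfl | rfl <;> simp
      rw [smul_add, smul_smul, hε, one_smul, add_comm]
  | zero => simp
  | add x y _ _ hx hy =>
    have := Submodule.add_mem _ hx hy
    convert this using 1
    rw [map_add]
    module
  | smul a x _ hx =>
    have := Submodule.smul_mem _ a hx
    convert this using 1
    rw [map_smul]
    module

/-- `S(lam)^ε` is stable under the alternating Hecke algebra. -/
lemma spechtAct_mem_spechtHalf (S : SquareRoots q n) (hlam : lam.transpose = lam) (ε : ℤˣ)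
    (a : altHecke q n) : ∀ v ∈ spechtHalf F n hlam ε,
      spechtAct S lam (a : Hecke q n) v ∈ spechtHalf F n hlam ε := by
  intro v hv
  induction hv using Submodule.span_induction with
  | mem x hx =>
    obtain ⟨t, ht, rfl⟩ := hx
    have hn : 2 ≤ n := by
      obtain ⟨x, hx, _⟩ := ht
      have := (t.1 x).2
      omega
    have h := tau_spechtAct S hlam (a : Hecke q n) (vec F t)
    rw [mem_altHecke.mp a.2] at h
    rw [map_add, map_smul, ← tau_vec, ← h]
    exact add_tau_mem_spechtHalf hlam hn ε _
  | zero => simp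
  | add x y _ _ hx hy => rw [map_add]; exact Submodule.add_mem _ hx hy
  | smul c x _ hx => rw [map_smul]; exact Submodule.smul_mem _ c hx

/-- `S(lam)^ε` as a right module over the alternating Hecke algebra, by restricting the action of
the Hecke algebra on `S(lam)`. -/
def halfRep (S : SquareRoots q n) (hlam : lam.transpose = lam) (ε : ℤˣ) :
    altHecke q n →ₐ[F] (Module.End F (spechtHalf F n hlam ε))ᵐᵒᵖ where
  toFun a := MulOpposite.op
    ((spechtAct S lam (a : Hecke q n)).restrict (spechtAct_mem_spechtHalf S hlam ε a))
  map_one' := by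
    apply MulOpposite.unop_injective
    ext v
    simp [spechtAct]
  map_mul' a b := by
    apply MulOpposite.unop_injective
    ext v
    simp [spechtAct]
  map_zero' := by
    apply MulOpposite.unop_injective
    ext v
    simp [spechtAct]
  map_add' a b := by
    apply MulOpposite.unop_injective
    ext v
    simp [spechtAct]
  commutes' c := by
    apply MulOpposite.unop_injective
    ext v
    simp [spechtAct, MulOpposite.algebraMap_apply, Module.algebraMap_end_apply]

/-- The character `χ_A^{lam ε}` of the module `S(lam)^ε` over the alternating Hecke algebra. -/
def halfChar (S : SquareRoots q n) (hlam : lam.transpose = lam) (ε : ℤˣ) (a : altHecke q n) : F :=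
  LinearMap.trace F (spechtHalf F n hlam ε) (halfRep S hlam ε a).unop

end

end AltHecke

namespace AltHecke

variable {F : Type*} [Field F] {q : Fˣ} {n : ℕ} {lam : YoungDiagram}

/-! Conjugating a tableau negates contents, hence axial distances and the coefficients `alpha`. This
is why the involution `tau` turns the action of `h` into that of `hash q n h` (`tau_spechtAct`), and
why elements fixed by `#` act by operators commuting with `tau`.

Let ε be the sign, f the action of an element of the alternating algebra, and e = ½(1 + ετ), which
makes sense because 2 ≠ 0. The map e sends everything into S(λ)^ε (`add_tau_mem_spechtHalf`) and is
the identity there (`tau_of_mem_spechtHalf`), so it is a projection onto S(λ)^ε. The operator fe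
therefore has range in S(λ)^ε and agrees with f on it. An operator with range in a subspace has the
same trace there as on the whole space, so the character of the half is tr(fe) = ½(tr f + ε tr(fτ)).
This is `halfChar_eq`; no basis of S(λ)^ε and no decomposition of S(λ) into two halves is needed.

For the second formula, the action of h^# is the conjugate of that of h by τ (`spechtAct_hash`), so
both h ↦ χ(h) and h ↦ χ(hτ) are invariant under `#` (`spechtChar_hash`, `spechtTauChar_hash`). For
even w the element A_w is the average of T_w and T_w^#, so each functional takes the same value at
A_w as at T_w. -/

lemma tau_tau (hlam : lam.transpose = lam) (v : Specht F lam n) :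
    tau F n hlam (tau F n hlam v) = v := by
  suffices h : tau F n hlam ∘ₗ tau F n hlam = LinearMap.id from DFunLike.congr_fun h v
  apply specht_ext
  intro t
  simp [tau_vec, conjStd_conjStd]

/-- Treating ε as a unit of ℤ mapped to the field handles both signs at once; the rest of the
argument only uses that ε is its own inverse. -/
lemma sign_mul_self (ε : ℤˣ) : ((ε : ℤ) : F) * ((ε : ℤ) : F) = 1 := by
  rcases Int.units_eq_one_or ε with rfl | rfl <;> simp

/-- `S(lam)^ε` is contained in the `ε`-eigenspace of `τ`. -/
lemma tau_of_mem_spechtHalf (hlam : lam.transpose = lam) (ε : ℤˣ) {v : Specht F lam n}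
    (hv : v ∈ spechtHalf F n hlam ε) : tau F n hlam v = ((ε : ℤ) : F) • v := by
  induction hv using Submodule.span_induction with
  | mem x hx =>
    obtain ⟨t, -, rfl⟩ := hx
    -- On a generator, τ(v_t + εv_{t'}) = v_{t'} + εv_t, which equals ε(v_t + εv_{t'}) because ε² =
    -- 1.
    rw [map_add, map_smul, tau_vec, tau_vec, conjStd_conjStd, smul_add, smul_smul,
      sign_mul_self, one_smul, add_comm]
  | zero => simp
  | add x y _ _ hx hy => rw [map_add, hx, hy, smul_add]
  | smul a x _ hx => rw [map_smul, hx, smul_comm]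

/-! ### Invariance of the two trace functionals under `#` -/

/-- The conjugate by `τ` of the action of `h` is the action of `h^#`. -/
lemma spechtAct_hash (S : SquareRoots q n) (hlam : lam.transpose = lam) (h : Hecke q n) :
    spechtAct S lam (hash q n h) = tau F n hlam ∘ₗ spechtAct S lam h ∘ₗ tau F n hlam := by
  refine LinearMap.ext fun v => ?_
  rw [LinearMap.comp_apply, LinearMap.comp_apply, tau_spechtAct, tau_tau]

lemma tau_comp_tau (hlam : lam.transpose = lam) :
    tau F n hlam ∘ₗ tau F n hlam = LinearMap.id :=
  LinearMap.ext (tau_tau hlam)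

/-- Since τ is its own inverse, this is invariance of the trace under conjugation: tr(τ h τ) = tr(h
τ τ) = tr(h). -/
lemma spechtChar_hash (S : SquareRoots q n) (hlam : lam.transpose = lam) (h : Hecke q n) :
    spechtChar S lam (hash q n h) = spechtChar S lam h := by
  rw [spechtChar, spechtAct_hash S hlam, LinearMap.trace_comp_comm', LinearMap.comp_assoc,
    tau_comp_tau, LinearMap.comp_id, spechtChar]

/-- Here the outer τ cancels one of the conjugating factors, leaving tr(τh), and cyclicity of the
trace moves the remaining τ to the other side. -/
lemma spechtTauChar_hash (S : SquareRoots q n) (hlam : lam.transpose = lam) (h : Hecke q n) :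
    spechtTauChar S hlam (hash q n h) = spechtTauChar S hlam h := by
  rw [spechtTauChar, spechtAct_hash S hlam, LinearMap.comp_assoc, LinearMap.comp_assoc,
    tau_comp_tau, LinearMap.comp_id, LinearMap.trace_comp_comm', spechtTauChar]

lemma spechtAct_add (S : SquareRoots q n) (lam : YoungDiagram) (x y : Hecke q n) :
    spechtAct S lam (x + y) = spechtAct S lam x + spechtAct S lam y := by
  simp [spechtAct]

lemma spechtAct_smul (S : SquareRoots q n) (lam : YoungDiagram) (c : F) (x : Hecke q n) :
    spechtAct S lam (c • x) = c • spechtAct S lam x := by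
  simp [spechtAct]

/-! ### The trace on one half via the projection -/

/-- The character of `S(lam)^ε` is the trace on `S(lam)` of the action composed with the projection
`½ (1 + ε τ)` onto `S(lam)^ε`. -/
theorem halfChar_eq (h2 : (2 : F) ≠ 0) (hn : 2 ≤ n) (S : SquareRoots q n)
    (hlam : lam.transpose = lam) (ε : ℤˣ) (a : altHecke q n) :
    halfChar S hlam ε a = (1 / 2 : F) * (spechtChar S lam (a : Hecke q n) +
      ((ε : ℤ) : F) * spechtTauChar S hlam (a : Hecke q n)) := by
  set f := spechtAct S lam (a : Hecke q n) with hf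
  -- This is f composed with ½(1 + ετ), already expanded so that its trace can be read off by
  -- linearity.
  set g : Specht F lam n →ₗ[F] Specht F lam n :=
    (1 / 2 : F) • (f + ((ε : ℤ) : F) • f ∘ₗ tau F n hlam) with hg
  have hgv (v) : g v = f ((1 / 2 : F) • (v + ((ε : ℤ) : F) • tau F n hlam v)) := by
    simp [hg]
  -- The projection lands in S(λ)^ε for every v. This uses `hn`: with 2 among the entries, one of t
  -- and t' has it in the first row. Then f preserves S(λ)^ε because `a` is fixed by `#`.
  have hmem (v) : g v ∈ spechtHalf F n hlam ε := by
    rw [hgv]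
    exact spechtAct_mem_spechtHalf S hlam ε a _
      (Submodule.smul_mem _ _ (add_tau_mem_spechtHalf hlam hn ε v))
  have hres : (halfRep S hlam ε a).unop = g.restrict (fun v _ => hmem v) := by
    refine LinearMap.ext fun v => Subtype.ext ?_
    change f v = g v
    -- On S(λ)^ε the projection is the identity: ½(v + ε·εv) = ½·2v = v. This is where 2 ≠ 0 enters.
    rw [hgv, tau_of_mem_spechtHalf hlam ε v.2, smul_smul, sign_mul_self, one_smul, ← two_smul F,
      smul_smul, one_div, inv_mul_cancel₀ h2, one_smul]
  -- As g maps all of S(λ) into S(λ)^ε, it induces zero on the quotient, so the quotient contributes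
  -- nothing to the trace.
  rw [halfChar, hres, LinearMap.trace_restrict_eq_of_forall_mem _ _ hmem]
  simp [hg, hf, spechtChar, spechtTauChar, mul_add]

/-! ### Values at the elements A_w -/

lemma even_length_of_mem_alternatingGroup (w : alternatingGroup (Fin n))
    (e : ReducedExpr (w : Equiv.Perm (Fin n))) : Even e.word.length := by
  have h1 := sign_word e.word
  rw [e.prod_eq, Equiv.Perm.mem_alternatingGroup.mp w.2] at h1
  by_contra hodd
  rw [(Nat.not_even_iff_odd.mp hodd).neg_one_pow] at h1
  -- The contradiction 1 = -1 lives in ℤˣ, so it does not depend on the characteristic of the field.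
  exact absurd h1 (by decide)

/-- For even w the sign in front of T_w^# disappears, so A_w is a plain average over the orbit of
T_w under `#`. -/
lemma coe_altA (w : alternatingGroup (Fin n)) (e : ReducedExpr (w : Equiv.Perm (Fin n))) :
    (altA q w e : Hecke q n) = (2 : F)⁻¹ • (heckeT q e + hash q n (heckeT q e)) := by
  change heckeA q e = _
  rw [heckeA, (even_length_of_mem_alternatingGroup w e).neg_one_pow, one_smul]

lemma spechtChar_altA (h2 : (2 : F) ≠ 0) (S : SquareRoots q n) (hlam : lam.transpose = lam)
    (w : alternatingGroup (Fin n)) (e : ReducedExpr (w : Equiv.Perm (Fin n))) :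
    spechtChar S lam (altA q w e : Hecke q n) = spechtChar S lam (heckeT q e) := by
  have h := spechtChar_hash S hlam (heckeT q e)
  -- The invariance under `#` is unfolded to an equality of traces, the form in which it applies
  -- once the trace of the average has been expanded to ½(tr T_w^# + tr T_w).
  rw [spechtChar, spechtChar] at h
  rw [coe_altA, spechtChar,
    spechtAct_smul, spechtAct_add, map_smul, map_add, h, spechtChar, smul_eq_mul, ← two_mul,
    inv_mul_cancel_left₀ h2]

/-- The same averaging argument, now with composition by τ, which is also linear in the acting
element. -/
lemma spechtTauChar_altA (h2 : (2 : F) ≠ 0) (S : SquareRoots q n) (hlam : lam.transpose = lam)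
    (w : alternatingGroup (Fin n)) (e : ReducedExpr (w : Equiv.Perm (Fin n))) :
    spechtTauChar S hlam (altA q w e : Hecke q n) = spechtTauChar S hlam (heckeT q e) := by
  have h := spechtTauChar_hash S hlam (heckeT q e)
  rw [spechtTauChar, spechtTauChar] at h
  rw [coe_altA, spechtTauChar,
    spechtAct_smul, spechtAct_add, LinearMap.smul_comp, LinearMap.add_comp, map_smul, map_add, h,
    spechtTauChar, smul_eq_mul, ← two_mul, inv_mul_cancel_left₀ h2]

end AltHecke

/-- In the second formula the same reduced expression `e` defines A_w and T_w, so independence of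
T_w from the choice of expression plays no role. -/
theorem mainTheorem7 {F : Type*} [Field F] (h2 : (2 : F) ≠ 0) (q : Fˣ) (n : ℕ) (hn : 2 ≤ n)
    (S : AltHecke.SquareRoots q n) (lam : YoungDiagram) (hcard : lam.card = n)
    (hlam : lam.transpose = lam) (ε : ℤˣ) :
    (∀ a : AltHecke.altHecke q n,
      AltHecke.halfChar S hlam ε a =
        (1 / 2 : F) * (AltHecke.spechtChar S lam (a : AltHecke.Hecke q n) +
          ((ε : ℤ) : F) * AltHecke.spechtTauChar S hlam (a : AltHecke.Hecke q n))) ∧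
    (∀ (w : alternatingGroup (Fin n)) (e : AltHecke.ReducedExpr (w : Equiv.Perm (Fin n))),
      AltHecke.halfChar S hlam ε (AltHecke.altA q w e) =
        (1 / 2 : F) * (AltHecke.spechtChar S lam (AltHecke.heckeT q e) +
          ((ε : ℤ) : F) * AltHecke.spechtTauChar S hlam (AltHecke.heckeT q e))) := by
  refine ⟨AltHecke.halfChar_eq h2 hn S hlam ε, fun w e => ?_⟩
  -- The first formula at a = A_w leaves traces at A_w; invariance under `#` replaces each by the
  -- trace at T_w.
  rw [AltHecke.halfChar_eq h2 hn, AltHecke.spechtChar_altA h2 S hlam,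
    AltHecke.spechtTauChar_altA h2]
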